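/- Call a non-negative Borel measure $\mu$ on $\mathbb{R}$ admissible if it has finite moments $s_k(\mu)=\int_{\mathbb{R}} x^k\,d\mu(x)$ of all orders $k\ge 0$ (with $x^0=1$). For $K\subseteq\mathbb{R}$ closed let $$\mathcal{M}(K)=\{(s_k(\mu))_{k\ge 0} : \mu \text{ admissible, supported on } K\},\qquad \mathcal{M}_n(K)=\{(s_0(\mu),\dots,s_n(\mu)) : \mu \text{ admissible, supported on } K\}.$$ A function $F:\mathbb{R}\to\mathbb{R}$ acts entrywise on finite and infinite real sequences; write $F[-]$ for this action. An absolutely monotonic entire function is an entire function whose Taylor coefficients at every point of $(0,\infty)$ are all real and non-negative. Let $F:\mathbb{R}\to\mathbb{R}$ and $u_0\in(0,1)$. The following are equivalent. (1) $F[-]$ maps $\mathcal{M}(\{-1,-u_0\})$ into $\mathcal{M}((-\infty,0])$, and maps $\mathcal{M}_4(\{-1,0\})\cup\bigcup_{u\in(0,1)}\mathcal{M}_4(\{-u\})$ into $\mathcal{M}_4((-\infty,0])$. (2) $F[-]$ maps $\mathcal{M}([-1,0])$ into itself. (3) There exists an absolutely monotonic entire function $\widetilde F$ such that $F(x)=\widetilde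 F(x)$ for $x>0$, $F(0)=0$, and $F(x)=-\widetilde F(-x)$ for $x<0$. Moreover, (3) is also equivalent to: $F[-]$ maps $\mathcal{M}([-1,0])$ into $\mathcal{M}((-\infty,0])$. Every $F$ as in (3) is odd, and there is an $F$ as in (3) that is discontinuous at $0$. -/

import Mathlib

open MeasureTheory Set

namespace MomentTransforms

/-- The admissible measures supported on `K`: (non-negative) Borel measures on `ℝ` having moments of
all orders (the order `0` makes them finite) and giving no mass to the complement of `K`.
For closed `K` the last condition says exactly that the topological support is contained in `K`. -/
def admissibleMeasures (K : Set ℝ) : Set (Measure ℝ) :=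
  {μ | (∀ k : ℕ, Integrable (fun x : ℝ => x ^ k) μ) ∧ μ Kᶜ = 0}

/-- The `k`-th moment of `μ`; here `x ^ 0 = 1`, also at `x = 0`. -/
noncomputable def moment (μ : Measure ℝ) (k : ℕ) : ℝ := ∫ x : ℝ, x ^ k ∂μ

/-- The set `𝓜(K)` of moment sequences of admissible measures supported on `K`. -/
def momentSeqs (K : Set ℝ) : Set (ℕ → ℝ) :=
  {s | ∃ μ ∈ admissibleMeasures K, ∀ k : ℕ, s k = moment μ k}

/-- The set `𝓜ₙ(K)` of truncated moment sequences `(s₀(μ), …, sₙ(μ))` of admissible measures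
supported on `K`. -/
def truncMomentSeqs (n : ℕ) (K : Set ℝ) : Set (Fin (n + 1) → ℝ) :=
  {s | ∃ μ ∈ admissibleMeasures K, ∀ k : Fin (n + 1), s k = moment μ (k : ℕ)}

/-- The entrywise action `F[-]` on finite or infinite sequences. -/
def entrywise {ι : Type*} (F : ℝ → ℝ) (s : ι → ℝ) : ι → ℝ := fun k => F (s k)

/-- Absolutely monotonic entire functions: entire functions all of whose Taylor coefficients at every
point of `(0, ∞)` are non-negative reals (equivalently, all derivatives are, as the Taylor
coefficient is the derivative divided by a factorial). -/
def AbsMonotonicEntire (G : ℂ → ℂ) : Prop :=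
  Differentiable ℂ G ∧
    ∀ x : ℝ, 0 < x → ∀ n : ℕ,
      0 ≤ (iteratedDeriv n G (x : ℂ)).re ∧ (iteratedDeriv n G (x : ℂ)).im = 0

/-- `F` is given by an absolutely monotonic entire function `G` on `(0, ∞)`, by `0` at `0`, and by
`x ↦ -G (-x)` on `(-∞, 0)`. -/
def IsOddAbsMonotonic (F : ℝ → ℝ) : Prop :=
  ∃ G : ℂ → ℂ, AbsMonotonicEntire G ∧
    (∀ x : ℝ, 0 < x → (F x : ℂ) = G (x : ℂ)) ∧
    F 0 = 0 ∧
    (∀ x : ℝ, x < 0 → (F x : ℂ) = -G (-(x : ℂ)))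

end MomentTransforms

section

open Filter Topology Polynomial
open scoped ContDiff

namespace MomentTransforms

/-! ### Smooth functions with non-negative derivatives -/

/-! Two small families of test measures force the form of `F`. The image of `a δ₋₁ + b δ₀`, tested
against `(1+x)²`, `x(1+x)²` and `x²(1+x)²` on `(-∞, 0]`, gives that `F` is odd and is non-negative
and monotone on `[0, ∞)` (`odd_monotone_of_mapsTo`). The even moments of `a δ₋₁ + b δ₋ᵤ` are `a + b
u²ᵏ`, so every non-negative polynomial `q` yields `∑ qₖ F(a + b u²ᵏ) ≥ 0`. After mollification,
Loewner's choice of `q` makes all derivatives non-negative; Bernstein's theorem expands the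
mollified functions in power series, and a limit gives the series for `F` on `(0, ∞)`
(`exists_powerSeries_of_monotone`).

Conversely, reflect the measure to `ν` on `[0, 1]`. The `m`-th multiplicative convolution power of
`ν` has as moments the `m`-th powers of those of `ν`, so `∑ cₘ ν^{*m}` realizes the transformed
moments, and oddness carries this back through the reflection (`IsOddAbsMonotonic.mapsTo`). -/

theorem exists_taylor_lagrange {g : ℝ → ℝ} (hg : ContDiff ℝ ∞ g) {x y : ℝ} (hxy : x < y) (n : ℕ) :
    ∃ ξ ∈ Ioo x y, g y = (∑ m ∈ Finset.range (n + 1),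
      iteratedDeriv m g x / (m.factorial : ℝ) * (y - x) ^ m) +
        iteratedDeriv (n + 1) g ξ * (y - x) ^ (n + 1) / ((n + 1).factorial : ℝ) := by
  have hgn : ∀ m : ℕ, ContDiff ℝ m g := contDiff_infty.1 hg
  obtain ⟨ξ, hξ, h⟩ := taylor_mean_remainder_lagrange_iteratedDeriv (n := n) hxy.ne
    (by exact_mod_cast (hgn (n + 1)).contDiffOn)
  rw [uIoo_of_lt hxy] at hξ
  refine ⟨ξ, hξ, ?_⟩
  rw [sub_eq_iff_eq_add'] at h
  rw [h, taylor_within_apply, uIcc_of_le hxy.le]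
  congr 1
  refine Finset.sum_congr rfl fun m _ => ?_
  rw [iteratedDerivWithin_eq_iteratedDeriv (uniqueDiffOn_Icc hxy) (hgn m).contDiffAt
    (left_mem_Icc.2 hxy.le), smul_eq_mul]
  ring

/-- All other Taylor terms and the Lagrange remainder are non-negative. This plays the role of a
Cauchy estimate. -/
theorem iteratedDeriv_mul_pow_div_le {g : ℝ → ℝ} (hg : ContDiff ℝ ∞ g) {a : ℝ}
    (h : ∀ n : ℕ, ∀ x, a ≤ x → 0 ≤ iteratedDeriv n g x) {x y : ℝ} (hx : a ≤ x) (hxy : x < y)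
    (n : ℕ) : iteratedDeriv n g x / (n.factorial : ℝ) * (y - x) ^ n ≤ g y := by
  obtain ⟨ξ, hξ, e⟩ := exists_taylor_lagrange hg hxy n
  have hyx : 0 ≤ y - x := by linarith
  have h1 : 0 ≤ iteratedDeriv (n + 1) g ξ * (y - x) ^ (n + 1) / ((n + 1).factorial : ℝ) := by
    have := h (n + 1) ξ (by linarith [hξ.1])
    positivity
  have h2 := Finset.single_le_sum (f := fun m => iteratedDeriv m g x / (m.factorial : ℝ) *
      (y - x) ^ m) (s := Finset.range (n + 1)) (fun m _ => by
        have := h m x hx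
        positivity) (Finset.self_mem_range_succ n)
  linarith

/-- Bernstein's theorem: the remainder at `x` is compared with the value of `g` at a point farther
right, which gains a geometric factor. -/
theorem hasSum_taylor_of_iteratedDeriv_nonneg {g : ℝ → ℝ} (hg : ContDiff ℝ ∞ g) {a : ℝ}
    (h : ∀ n : ℕ, ∀ x, a ≤ x → 0 ≤ iteratedDeriv n g x) {x : ℝ} (hx : a < x) :
    HasSum (fun m => iteratedDeriv m g a / (m.factorial : ℝ) * (x - a) ^ m) (g x) := by
  have hxa : 0 < x - a := by linarith
  rw [hasSum_iff_tendsto_nat_of_nonneg (fun m => by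
    have := h m a le_rfl
    positivity), ← tendsto_add_atTop_iff_nat 1]
  have hlim : Tendsto (fun n : ℕ => g x - g (3 * x - 2 * a) * (1 / 2 : ℝ) ^ (n + 1)) atTop
      (𝓝 (g x)) := by
    have := (tendsto_pow_atTop_nhds_zero_of_lt_one (r := (1 / 2 : ℝ)) (by norm_num)
      (by norm_num)).comp (tendsto_add_atTop_nat 1)
    simpa using (this.const_mul (g (3 * x - 2 * a))).const_sub (g x)
  refine tendsto_of_tendsto_of_tendsto_of_le_of_le hlim tendsto_const_nhds (fun n => ?_)
    fun n => ?_
  all_goals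
    obtain ⟨ξ, hξ, e⟩ := exists_taylor_lagrange hg hx n
    have hd := h (n + 1) ξ hξ.1.le
  -- The point `3x - 2a` is at distance at least `2(x - a)` from every `ξ < x`, so the remainder is
  -- at most `g (3x - 2a) / 2ⁿ⁺¹`.
  · have h1 := iteratedDeriv_mul_pow_div_le hg h hξ.1.le (y := 3 * x - 2 * a)
      (by linarith [hξ.2]) (n + 1)
    have h2 : (2 * (x - a)) ^ (n + 1) ≤ (3 * x - 2 * a - ξ) ^ (n + 1) :=
      pow_le_pow_left₀ (by linarith) (by linarith [hξ.2]) _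
    have h3 : iteratedDeriv (n + 1) g ξ / ((n + 1).factorial : ℝ) * (2 * (x - a)) ^ (n + 1) ≤
        g (3 * x - 2 * a) := le_trans (by gcongr) h1
    have h4 : iteratedDeriv (n + 1) g ξ * (x - a) ^ (n + 1) / ((n + 1).factorial : ℝ) =
        iteratedDeriv (n + 1) g ξ / ((n + 1).factorial : ℝ) * (2 * (x - a)) ^ (n + 1) *
          (1 / 2 : ℝ) ^ (n + 1) := by
      rw [mul_assoc, ← mul_pow]
      ring_nf
    have h5 : iteratedDeriv (n + 1) g ξ * (x - a) ^ (n + 1) / ((n + 1).factorial : ℝ) ≤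
        g (3 * x - 2 * a) * (1 / 2 : ℝ) ^ (n + 1) := by
      rw [h4]
      gcongr
    simp only
    linarith
  · have : 0 ≤ iteratedDeriv (n + 1) g ξ * (x - a) ^ (n + 1) / ((n + 1).factorial : ℝ) := by
      positivity
    simp only
    linarith

/-- Loewner's argument: a polynomial with roots `1, v, …, v ^ (n - 1)` that is positive at `v ^ n`
extracts the sign of the `n`-th derivative. -/
theorem iteratedDeriv_nonneg_of_sum_coeff_nonneg {g : ℝ → ℝ} (hg : ContDiff ℝ ∞ g) {a v : ℝ}
    {n : ℕ} {q : ℝ[X]} (hq0 : ∀ m < n, q.eval (v ^ m) = 0) (hqn : 0 < q.eval (v ^ n))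
    (h : ∀ b : ℝ, 0 < b → 0 ≤ ∑ k ∈ q.support, q.coeff k * g (a + b * v ^ k)) :
    0 ≤ iteratedDeriv n g a := by
  set H : ℝ → ℝ := fun b => ∑ k ∈ q.support, q.coeff k * g (a + b * v ^ k) with hH
  have hgn : ∀ m : ℕ, ContDiff ℝ m g := contDiff_infty.1 hg
  have hterm : ∀ k m : ℕ, ContDiff ℝ m (fun b => q.coeff k * g (a + b * v ^ k)) := fun k m =>
    contDiff_const.mul ((hgn m).comp (by fun_prop))
  have hHc : ContDiff ℝ n H := ContDiff.sum fun k _ => hterm k n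
  have hder : ∀ m : ℕ, iteratedDeriv m H 0 = q.eval (v ^ m) * iteratedDeriv m g a := by
    intro m
    rw [hH, iteratedDeriv_fun_sum fun k _ => (hterm k m).contDiffAt, Polynomial.eval_eq_sum,
      Polynomial.sum_def, Finset.sum_mul]
    refine Finset.sum_congr rfl fun k _ => ?_
    rw [iteratedDeriv_const_mul_field]
    have h1 : (fun b : ℝ => g (a + b * v ^ k)) = fun b => (fun z => g (a + z)) (v ^ k * b) := by
      ext b
      simp [mul_comm]
    have h2 : ContDiff ℝ m (fun z => g (a + z)) := (hgn m).comp (by fun_prop)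
    rw [h1, iteratedDeriv_comp_const_mul h2, iteratedDeriv_comp_const_add]
    simp only [mul_zero, add_zero]
    ring
  have ht := taylor_tendsto convex_univ (mem_univ (0 : ℝ)) hHc.contDiffOn
  have htay : ∀ b : ℝ, taylorWithinEval H n univ 0 b =
      b ^ n / (n.factorial : ℝ) * (q.eval (v ^ n) * iteratedDeriv n g a) := by
    intro b
    rw [taylor_within_apply, Finset.sum_range_succ, Finset.sum_eq_zero, zero_add,
      iteratedDerivWithin_univ, hder, smul_eq_mul, sub_zero]
    · ring
    · intro m hm
      rw [iteratedDerivWithin_univ, hder, hq0 m (Finset.mem_range.1 hm)]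
      simp
  -- Since `q` kills the derivatives of `H` at `0` of order below `n`, `H b` behaves like its `n`-th
  -- Taylor term.
  have ht2 : Tendsto (fun b => (b ^ n)⁻¹ * H b) (𝓝[>] (0 : ℝ))
      (𝓝 (0 + (q.eval (v ^ n) * iteratedDeriv n g a) / (n.factorial : ℝ))) := by
    refine Tendsto.congr' ?_ ((ht.mono_left (nhdsWithin_mono _ (subset_univ (Ioi 0)))).add_const _)
    filter_upwards [self_mem_nhdsWithin] with b (hb : 0 < b)
    rw [htay, sub_zero, smul_eq_mul]
    field_simp
    ring
  have h0 : 0 ≤ 0 + (q.eval (v ^ n) * iteratedDeriv n g a) / (n.factorial : ℝ) := by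
    refine ge_of_tendsto ht2 ?_
    filter_upwards [self_mem_nhdsWithin] with b (hb : 0 < b)
    have := h b hb
    positivity
  rw [zero_add] at h0
  by_contra! hneg
  have : (q.eval (v ^ n) * iteratedDeriv n g a) / (n.factorial : ℝ) < 0 :=
    div_neg_of_neg_of_pos (mul_neg_of_pos_of_neg hqn hneg) (by positivity)
  linarith

/-! ### Power series with non-negative coefficients -/

theorem norm_coeff_mul_pow_le {c : ℕ → ℝ} (hc : ∀ m, 0 ≤ c m) (R : ℝ) :
    ∀ i, ∀ w ∈ Metric.ball (0 : ℂ) R, ‖(c i : ℂ) * w ^ i‖ ≤ c i * R ^ i := by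
  intro i w hw
  rw [mem_ball_zero_iff] at hw
  rw [norm_mul, norm_pow, Complex.norm_real, Real.norm_of_nonneg (hc i)]
  have := hc i
  gcongr

theorem differentiable_tsum {c : ℕ → ℝ} (hc : ∀ m, 0 ≤ c m)
    (hs : ∀ x : ℝ, 0 < x → Summable fun m => c m * x ^ m) :
    Differentiable ℂ fun z : ℂ => ∑' m, (c m : ℂ) * z ^ m := by
  intro z
  have hR : 0 < ‖z‖ + 1 := by positivity
  exact (Complex.differentiableOn_tsum_of_summable_norm (hs _ hR) (fun i => by fun_prop)
    Metric.isOpen_ball (norm_coeff_mul_pow_le hc _)).differentiableAt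
    (Metric.isOpen_ball.mem_nhds (by simp))

/-- Termwise differentiation stays within everywhere convergent series with non-negative
coefficients, so derivatives of all orders follow by induction. -/
theorem exists_deriv_tsum {c : ℕ → ℝ} (hc : ∀ m, 0 ≤ c m)
    (hs : ∀ x : ℝ, 0 < x → Summable fun m => c m * x ^ m) :
    ∃ d : ℕ → ℝ, (∀ m, 0 ≤ d m) ∧ (∀ x : ℝ, 0 < x → Summable fun m => d m * x ^ m) ∧
      deriv (fun z : ℂ => ∑' m, (c m : ℂ) * z ^ m) = fun z => ∑' m, (d m : ℂ) * z ^ m := by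
  have key : ∀ z : ℂ, HasSum (fun m : ℕ => (((m + 1 : ℕ) * c (m + 1) : ℝ) : ℂ) * z ^ m)
      (deriv (fun z : ℂ => ∑' m, (c m : ℂ) * z ^ m) z) := by
    intro z
    have hR : 0 < ‖z‖ + 1 := by positivity
    have h := Complex.hasSum_deriv_of_summable_norm (hs _ hR) (fun i => by fun_prop)
      Metric.isOpen_ball (norm_coeff_mul_pow_le hc _) (z := z) (by simp)
    rw [← hasSum_nat_add_iff' 1] at h
    simp only [Finset.range_one, Finset.sum_singleton, pow_zero, deriv_const_mul_field',
      deriv_const, mul_zero, sub_zero] at h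
    refine h.congr_fun fun m => ?_
    simp
    ring
  refine ⟨fun m => (m + 1 : ℕ) * c (m + 1), fun m => mul_nonneg (by positivity) (hc _),
    fun x _ => ?_, funext fun z => (key z).tsum_eq.symm⟩
  have := (key x).summable
  exact_mod_cast this

theorem absMonotonicEntire_tsum {c : ℕ → ℝ} (hc : ∀ m, 0 ≤ c m)
    (hs : ∀ x : ℝ, 0 < x → Summable fun m => c m * x ^ m) :
    AbsMonotonicEntire fun z : ℂ => ∑' m, (c m : ℂ) * z ^ m := by
  refine ⟨differentiable_tsum hc hs, fun x hx n => ?_⟩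
  have : ∃ d : ℕ → ℝ, (∀ m, 0 ≤ d m) ∧
      (∀ x : ℝ, 0 < x → Summable fun m => d m * x ^ m) ∧
      iteratedDeriv n (fun z : ℂ => ∑' m, (c m : ℂ) * z ^ m) =
        fun z => ∑' m, (d m : ℂ) * z ^ m := by
    induction n with
    | zero => exact ⟨c, hc, hs, iteratedDeriv_zero⟩
    | succ n ih =>
      obtain ⟨d, hd, hds, e⟩ := ih
      rw [iteratedDeriv_succ, e]
      exact exists_deriv_tsum hd hds
  obtain ⟨d, hd, hds, e⟩ := this
  have e2 : (∑' m, (d m : ℂ) * (x : ℂ) ^ m) = ((∑' m, d m * x ^ m : ℝ) : ℂ) := by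
    push_cast
    rfl
  rw [e]
  simp only [e2, Complex.ofReal_re, Complex.ofReal_im, and_true]
  exact tsum_nonneg fun m => mul_nonneg (hd m) (pow_nonneg hx.le m)

/-- An absolutely monotonic entire function is the sum of a power series with non-negative
coefficients. -/
theorem AbsMonotonicEntire.exists_hasSum {G : ℂ → ℂ} (hG : AbsMonotonicEntire G) :
    ∃ c : ℕ → ℝ, (∀ m, 0 ≤ c m) ∧ ∀ x : ℝ, HasSum (fun m => ((c m * x ^ m : ℝ) : ℂ)) (G x) := by
  have hcont : ∀ n, Continuous (iteratedDeriv n G) := fun n =>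
    (hG.1.contDiff (n := n)).continuous_iteratedDeriv n le_rfl
  have hmem : ∀ n, 0 ≤ (iteratedDeriv n G 0).re ∧ (iteratedDeriv n G 0).im = 0 := by
    intro n
    -- Non-negativity is given only on `(0, ∞)`; continuity carries it to the centre `0`.
    have ht : Tendsto (fun x : ℝ => iteratedDeriv n G (x : ℂ)) (𝓝[>] 0)
        (𝓝 (iteratedDeriv n G 0)) := by
      have : Continuous fun x : ℝ => iteratedDeriv n G (x : ℂ) :=
        (hcont n).comp Complex.continuous_ofReal
      simpa using (this.tendsto 0).mono_left (nhdsWithin_le_nhds (s := Ioi 0))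
    have hcl : IsClosed {z : ℂ | 0 ≤ z.re ∧ z.im = 0} :=
      (isClosed_le continuous_const Complex.continuous_re).inter
        (isClosed_eq Complex.continuous_im continuous_const)
    refine hcl.mem_of_tendsto ht ?_
    filter_upwards [self_mem_nhdsWithin] with x hx using hG.2 x hx n
  refine ⟨fun m => (m.factorial : ℝ)⁻¹ * (iteratedDeriv m G 0).re,
    fun m => mul_nonneg (by positivity) (hmem m).1, fun x => ?_⟩
  refine (Complex.hasSum_taylorSeries_of_entire hG.1 0 x).congr_fun fun m => ?_
  have : iteratedDeriv m G 0 = ((iteratedDeriv m G 0).re : ℂ) :=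
    Complex.ext (by simp) (by simp [(hmem m).2])
  rw [this]
  simp
  ring

/-! ### Smoothing of monotone functions -/

/-- Convolution with a normalized bump supported in `[-δ, δ]` averages translates of `f`:
monotonicity gives the two-sided bound, and linear inequalities valid for all the translates survive
averaging. -/
theorem exists_smooth_approx {f : ℝ → ℝ} (hf : Monotone f) {δ : ℝ} (hδ : 0 < δ) :
    ∃ g : ℝ → ℝ, ContDiff ℝ ∞ g ∧ (∀ x, f (x - δ) ≤ g x ∧ g x ≤ f (x + δ)) ∧
      ∀ (s : Finset ℕ) (c p : ℕ → ℝ) (a : ℝ),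
        (∀ t, |t| < δ → 0 ≤ ∑ k ∈ s, c k * f (a - t + p k)) →
          0 ≤ ∑ k ∈ s, c k * g (a + p k) := by
  let φ : ContDiffBump (0 : ℝ) := ⟨δ / 2, δ, by positivity, by linarith⟩
  have hloc : LocallyIntegrable f volume := hf.locallyIntegrable
  have hex : ∀ x, Integrable (fun t => φ.normed volume t * f (x - t)) := fun x =>
    φ.hasCompactSupport_normed.convolutionExists_left (ContinuousLinearMap.lsmul ℝ ℝ)
      φ.continuous_normed hloc x
  have hsupp : ∀ t, δ ≤ |t| → φ.normed volume t = 0 := by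
    intro t ht
    by_contra hne
    have : t ∈ Function.support (φ.normed volume) := hne
    rw [φ.support_normed_eq, mem_ball_zero_iff, Real.norm_eq_abs] at this
    exact absurd this (not_lt.2 ht)
  have hconst : ∀ y : ℝ, ∫ t, φ.normed volume t * y = y := fun y => by
    rw [integral_mul_const, φ.integral_normed, one_mul]
  have hconsti : ∀ y : ℝ, Integrable fun t => φ.normed volume t * y := fun y =>
    φ.integrable_normed.mul_const y
  refine ⟨fun x => ∫ t, φ.normed volume t * f (x - t),
    φ.hasCompactSupport_normed.contDiff_convolution_left (ContinuousLinearMap.lsmul ℝ ℝ)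
      φ.contDiff_normed hloc, fun x => ⟨?_, ?_⟩, fun s c p a h => ?_⟩
  · rw [← hconst (f (x - δ))]
    refine integral_mono (hconsti _) (hex x) fun t => ?_
    rcases le_or_gt δ |t| with ht | ht
    · simp [hsupp t ht]
    · exact mul_le_mul_of_nonneg_left (hf (by linarith [(abs_lt.1 ht).2])) (φ.nonneg_normed t)
  · rw [← hconst (f (x + δ))]
    refine integral_mono (hex x) (hconsti _) fun t => ?_
    rcases le_or_gt δ |t| with ht | ht
    · simp [hsupp t ht]
    · exact mul_le_mul_of_nonneg_left (hf (by linarith [(abs_lt.1 ht).1])) (φ.nonneg_normed t)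
  · simp only
    simp_rw [← integral_const_mul]
    rw [← integral_finsetSum _ fun k _ => (hex _).const_mul _]
    refine integral_nonneg fun t => ?_
    have e : ∑ k ∈ s, c k * (φ.normed volume t * f (a + p k - t)) =
        φ.normed volume t * ∑ k ∈ s, c k * f (a - t + p k) := by
      rw [Finset.mul_sum]
      refine Finset.sum_congr rfl fun k _ => ?_
      rw [show a + p k - t = a - t + p k by ring]
      ring
    simp only [e, Pi.zero_apply]
    rcases le_or_gt δ |t| with ht | ht
    · simp [hsupp t ht]
    · exact mul_nonneg (φ.nonneg_normed t) (h t ht)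

/-! ### Power series expansion of monotone functions -/

theorem exists_separating_polynomial {v : ℝ} (hv0 : 0 < v) (hv1 : v < 1) (n : ℕ) :
    ∃ q : ℝ[X], (∀ x, 0 ≤ q.eval x) ∧ (∀ m < n, q.eval (v ^ m) = 0) ∧ 0 < q.eval (v ^ n) := by
  refine ⟨(∏ p ∈ Finset.range n, (X - C (v ^ p))) ^ 2, fun x => ?_, fun m hm => ?_, ?_⟩
  · rw [eval_pow]
    positivity
  · rw [eval_pow, eval_prod, Finset.prod_eq_zero (Finset.mem_range.2 hm) (by simp)]
    simp
  · rw [eval_pow, eval_prod]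
    refine sq_pos_of_ne_zero (Finset.prod_ne_zero_iff.2 fun p hp => ?_)
    have := pow_lt_pow_right_of_lt_one₀ hv0 hv1 (Finset.mem_range.1 hp)
    simpa [sub_eq_zero] using this.ne

/-- A monotone function mapping the moment sequences `(a + b v ^ k)` to sequences
non-negative on non-negative polynomials is, on `(0, ∞)`, the sum of a power series with non-negative
coefficients. -/
theorem exists_powerSeries_of_monotone {f : ℝ → ℝ} (hf : Monotone f)
    {v : ℝ} (hv0 : 0 < v) (hv1 : v < 1)
    (h : ∀ q : ℝ[X], (∀ x, 0 ≤ q.eval x) → ∀ a b : ℝ, 0 < a → 0 < b →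
      0 ≤ ∑ k ∈ q.support, q.coeff k * f (a + b * v ^ k)) :
    ∃ c : ℕ → ℝ, (∀ m, 0 ≤ c m) ∧ (∀ x : ℝ, 0 < x → Summable fun m => c m * x ^ m) ∧
      ∀ x : ℝ, 0 < x → f x = ∑' m, c m * x ^ m := by
  set δ : ℕ → ℝ := fun j => 1 / ((j : ℝ) + 1) with hδdef
  have hδ : ∀ j, 0 < δ j := fun j => Nat.one_div_pos_of_nat
  have hδ1 : ∀ j, δ j ≤ 1 := fun j => by
    rw [hδdef]
    exact div_le_one_of_le₀ (by linarith [(Nat.cast_nonneg j : (0 : ℝ) ≤ j)]) (by positivity)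
  have hδt : Tendsto δ atTop (𝓝 0) := tendsto_one_div_add_atTop_nhds_zero_nat
  choose g hg hgf hgsum using fun j => exists_smooth_approx hf (hδ j)
  -- To the right of `2 δ j` every translate by less than `δ j` keeps the base point positive.
  have hder : ∀ j, ∀ n : ℕ, ∀ x, 2 * δ j ≤ x → 0 ≤ iteratedDeriv n (g j) x := by
    intro j n x hx
    obtain ⟨q, hq, hq0, hqn⟩ := exists_separating_polynomial hv0 hv1 n
    refine iteratedDeriv_nonneg_of_sum_coeff_nonneg (hg j) hq0 hqn fun b hb => ?_
    refine hgsum j _ _ (fun k => b * v ^ k) x fun t ht => h q hq _ b ?_ hb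
    linarith [(abs_lt.1 ht).2, hδ j]
  set c : ℕ → ℕ → ℝ := fun j m => iteratedDeriv m (g j) (2 * δ j) / (m.factorial : ℝ) with hc
  have hc0 : ∀ j m, 0 ≤ c j m := fun j m => div_nonneg (hder j m _ le_rfl) (by positivity)
  have hcR : ∀ j m, ∀ R : ℝ, 0 < R → c j m * R ^ m ≤ f (R + 3) := by
    intro j m R hR
    have := iteratedDeriv_mul_pow_div_le (hg j) (hder j) le_rfl (y := 2 * δ j + R)
      (by linarith) m
    rw [add_sub_cancel_left] at this
    exact this.trans ((hgf j _).2.trans (hf (by linarith [hδ1 j])))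
  -- An ultrafilter makes all the bounded coefficient sequences converge at once, replacing a
  -- diagonal subsequence.
  set U : Ultrafilter ℕ := hyperfilter ℕ
  have hU : (U : Filter ℕ) ≤ atTop := Nat.hyperfilter_le_atTop
  have hlim : ∀ m, ∃ d : ℝ, Tendsto (fun j => c j m) U (𝓝 d) := by
    intro m
    obtain ⟨d, -, hd⟩ := (isCompact_Icc (a := (0 : ℝ)) (b := f (1 + 3))).ultrafilter_le_nhds
      (U.map fun j => c j m) (by
        rw [le_principal_iff]
        exact Eventually.of_forall (f := (U : Filter ℕ)) fun j =>
          ⟨hc0 j m, by simpa using hcR j m 1 one_pos⟩)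
    exact ⟨d, hd⟩
  choose d hd using hlim
  have hd0 : ∀ m, 0 ≤ d m := fun m => ge_of_tendsto (hd m) (Eventually.of_forall fun j => hc0 j m)
  -- Estimating at `2x` instead of `x` gives a geometric majorant uniform in `j`.
  have hbd : ∀ j m, ∀ x : ℝ, 0 < x → c j m * x ^ m ≤ f (2 * x + 3) * (1 / 2) ^ m := by
    intro j m x hx
    have h1 := hcR j m (2 * x) (by positivity)
    have h2 : c j m * x ^ m = c j m * (2 * x) ^ m * (1 / 2) ^ m := by
      rw [mul_assoc, ← mul_pow]
      ring_nf
    rw [h2]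
    gcongr
  have hgeom : ∀ x : ℝ, Summable fun m : ℕ => f (2 * x + 3) * (1 / 2 : ℝ) ^ m := fun x =>
    (summable_geometric_of_lt_one (by norm_num) (by norm_num)).mul_left _
  have hds : ∀ x : ℝ, 0 < x → Summable fun m => d m * x ^ m := by
    intro x hx
    refine Summable.of_nonneg_of_le (fun m => mul_nonneg (hd0 m) (by positivity))
      (fun m => ?_) (hgeom x)
    exact le_of_tendsto ((hd m).mul_const _) (Eventually.of_forall fun j => hbd j m x hx)
  refine ⟨d, hd0, hds, ?_⟩
  have hcontP : ∀ x : ℝ, 0 < x → ContinuousAt (fun x : ℝ => ∑' m, d m * x ^ m) x := by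
    intro x hx
    have h1 : Continuous fun x : ℝ => (∑' m, (d m : ℂ) * (x : ℂ) ^ m).re :=
      Complex.continuous_re.comp
        ((differentiable_tsum hd0 hds).continuous.comp Complex.continuous_ofReal)
    have h2 : (fun x : ℝ => ∑' m, d m * x ^ m) =
        fun x : ℝ => (∑' m, (d m : ℂ) * (x : ℂ) ^ m).re := by
      ext x
      rw [← Complex.ofReal_re (∑' m, d m * x ^ m)]
      push_cast
      rfl
    rw [h2]
    exact h1.continuousAt
  have hcontf : ∀ x : ℝ, 0 < x → ContinuousAt f x → f x = ∑' m, d m * x ^ m := by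
    intro x hx hfx
    have hδU : Tendsto δ U (𝓝 0) := hδt.mono_left hU
    have h1 : Tendsto (fun j => g j x) U (𝓝 (f x)) := by
      refine tendsto_of_tendsto_of_tendsto_of_le_of_le (g := fun j => f (x - δ j))
        (h := fun j => f (x + δ j)) ?_ ?_ (fun j => (hgf j x).1) (fun j => (hgf j x).2)
      · refine hfx.tendsto.comp ?_
        simpa using hδU.const_sub x
      · refine hfx.tendsto.comp ?_
        simpa using hδU.const_add x
    have hev : ∀ᶠ j in (U : Filter ℕ), 2 * δ j < x := by
      have := (hδU.const_mul 2).eventually_lt_const (by simpa using hx)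
      exact this
    have h2 : Tendsto (fun j => ∑' m, c j m * (x - 2 * δ j) ^ m) U (𝓝 (∑' m, d m * x ^ m)) := by
      refine tendsto_tsum_of_dominated_convergence (hgeom x) (fun m => ?_) ?_
      · refine (hd m).mul (Tendsto.pow ?_ m)
        simpa using (hδU.const_mul 2).const_sub x
      · filter_upwards [hev] with j hj m
        have h0 : 0 ≤ x - 2 * δ j := by linarith
        rw [Real.norm_of_nonneg (mul_nonneg (hc0 j m) (pow_nonneg h0 m))]
        refine le_trans ?_ (hbd j m x hx)
        have h3 : x - 2 * δ j ≤ x := by linarith [hδ j]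
        have := hc0 j m
        gcongr
    refine tendsto_nhds_unique h1 (h2.congr' ?_)
    filter_upwards [hev] with j hj
    exact (hasSum_taylor_of_iteratedDeriv_nonneg (hg j) (hder j) hj).tsum_eq
  -- A monotone function has countably many discontinuities; between its continuity points,
  -- monotonicity and the continuity of the sum force equality.
  have hdense : Dense {x | ContinuousAt f x} := by
    have := (hf.countable_not_continuousAt).dense_compl ℝ
    simpa [compl_ofPred] using this
  intro x hx
  by_contra hne
  rcases lt_or_gt_of_ne hne with hlt | hlt
  · have hev := ((hcontP x hx).eventually_const_lt hlt).and (eventually_gt_nhds hx)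
    obtain ⟨l, hl, hl2⟩ := exists_Ioc_subset_of_mem_nhds hev (exists_lt x)
    obtain ⟨y, hy, hy2⟩ := hdense.exists_between hl
    have := hl2 ⟨hy2.1, hy2.2.le⟩
    have h1 := hcontf y this.2 hy
    linarith [hf hy2.2.le, this.1]
  · have hev := ((hcontP x hx).eventually_lt_const hlt).and (eventually_gt_nhds hx)
    obtain ⟨l, hl, hl2⟩ := exists_Ico_subset_of_mem_nhds hev (exists_gt x)
    obtain ⟨y, hy, hy2⟩ := hdense.exists_between hl
    have := hl2 ⟨hy2.1.le, hy2.2⟩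
    have h1 := hcontf y this.2 hy
    linarith [hf hy2.1.le, this.1]

/-! ### Moments of measures on `[-1, 1]` and of their multiplicative convolution powers -/

theorem integrable_pow_of_support {μ : Measure ℝ} [IsFiniteMeasure μ]
    (h : μ (Icc (-1) 1)ᶜ = 0) (k : ℕ) : Integrable (fun x : ℝ => x ^ k) μ := by
  refine Integrable.of_bound (by fun_prop) 1 ?_
  have : ∀ᵐ x ∂μ, x ∈ Icc (-1 : ℝ) 1 := mem_ae_iff.2 h
  filter_upwards [this] with x hx
  rw [norm_pow]
  exact pow_le_one₀ (norm_nonneg _) (abs_le.2 hx)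

theorem isFiniteMeasure_of_mem {K : Set ℝ} {μ : Measure ℝ} (hμ : μ ∈ admissibleMeasures K) :
    IsFiniteMeasure μ := by
  have h := hμ.1 0
  simp only [pow_zero] at h
  exact (integrable_const_iff_isFiniteMeasure one_ne_zero).1 h

theorem moment_map_neg (μ : Measure ℝ) (k : ℕ) :
    moment (μ.map Neg.neg) k = (-1) ^ k * moment μ k := by
  rw [moment, moment, integral_map measurable_neg.aemeasurable (by fun_prop),
    ← integral_const_mul]
  refine integral_congr_ae (Eventually.of_forall fun x => ?_)
  simp only
  rw [neg_pow]

theorem moment_mconv (μ ν : Measure ℝ) [IsFiniteMeasure μ] [IsFiniteMeasure ν] (k : ℕ) :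
    moment (μ.mconv ν) k = moment μ k * moment ν k := by
  rw [moment, moment, moment, Measure.mconv, integral_map (by fun_prop) (by fun_prop)]
  simp_rw [mul_pow]
  exact integral_prod_mul (fun x : ℝ => x ^ k) fun x => x ^ k

/-- The multiplicative convolution powers of a measure. -/
noncomputable def mulPow (ν : Measure ℝ) : ℕ → Measure ℝ
  | 0 => Measure.dirac 1
  | n + 1 => (mulPow ν n).mconv ν

theorem mconv_compl_Icc {μ ν : Measure ℝ} [IsFiniteMeasure μ] [IsFiniteMeasure ν]
    (hμ : μ (Icc 0 1)ᶜ = 0) (hν : ν (Icc 0 1)ᶜ = 0) : (μ.mconv ν) (Icc 0 1)ᶜ = 0 := by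
  rw [Measure.mconv, Measure.map_apply (by fun_prop) measurableSet_Icc.compl]
  refine measure_mono_null (t := ((Icc 0 1)ᶜ ×ˢ univ) ∪ (univ ×ˢ (Icc 0 1)ᶜ)) ?_ ?_
  · rintro ⟨x, y⟩ h
    by_contra hc
    simp only [mem_union, mem_prod, mem_univ, and_true, true_and, mem_compl_iff, not_or,
      not_not] at hc
    exact h ⟨mul_nonneg hc.1.1 hc.2.1, mul_le_one₀ hc.1.2 hc.2.1 hc.2.2⟩
  · refine measure_union_null ?_ ?_ <;> simp [Measure.prod_prod, hμ, hν]

theorem mulPow_spec {ν : Measure ℝ} [IsFiniteMeasure ν] (hν : ν (Icc 0 1)ᶜ = 0) (n : ℕ) :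
    IsFiniteMeasure (mulPow ν n) ∧ mulPow ν n (Icc 0 1)ᶜ = 0 ∧
      ∀ k, moment (mulPow ν n) k = moment ν k ^ n := by
  induction n with
  | zero =>
    refine ⟨by rw [mulPow]; infer_instance, ?_, fun k => ?_⟩
    · rw [mulPow, Measure.dirac_apply' _ measurableSet_Icc.compl]
      simp
    · simp [mulPow, moment]
  | succ n ih =>
    obtain ⟨h1, h2, h3⟩ := ih
    refine ⟨?_, mconv_compl_Icc h2 hν, fun k => ?_⟩
    · rw [mulPow, Measure.mconv]
      infer_instance
    · rw [mulPow, moment_mconv, h3, pow_succ]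

/-- A power series with non-negative coefficients transforms moments of a measure on `[0, 1]` into
moments of a measure on `[0, 1]`. -/
theorem exists_measure_powerSeries {ν : Measure ℝ} [IsFiniteMeasure ν] (hν : ν (Icc 0 1)ᶜ = 0)
    {c : ℕ → ℝ} (hc : ∀ m, 0 ≤ c m) (hs : Summable fun m => c m * moment ν 0 ^ m) :
    ∃ σ : Measure ℝ, IsFiniteMeasure σ ∧ σ (Icc 0 1)ᶜ = 0 ∧
      ∀ k, HasSum (fun m => c m * moment ν k ^ m) (moment σ k) := by
  have hp := mulPow_spec hν
  have hfin : ∀ n, IsFiniteMeasure (mulPow ν n) := fun n => (hp n).1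
  set σ : Measure ℝ := Measure.sum fun n => ENNReal.ofReal (c n) • mulPow ν n with hσ
  have huniv : ∀ n, mulPow ν n univ = ENNReal.ofReal (moment ν 0 ^ n) := by
    intro n
    rw [← (hp n).2.2 0, moment]
    simp [measureReal_def, ENNReal.ofReal_toReal]
  have hσfin : IsFiniteMeasure σ := by
    refine ⟨?_⟩
    rw [hσ, Measure.sum_apply _ MeasurableSet.univ]
    simp only [Measure.smul_apply, smul_eq_mul, huniv]
    simp_rw [← ENNReal.ofReal_mul (hc _)]
    exact hs.tsum_ofReal_lt_top
  have hσsupp : σ (Icc 0 1)ᶜ = 0 := by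
    rw [hσ, Measure.sum_apply _ measurableSet_Icc.compl]
    simp [(hp _).2.1]
  refine ⟨σ, hσfin, hσsupp, fun k => ?_⟩
  have hint : Integrable (fun x : ℝ => x ^ k) σ := by
    refine integrable_pow_of_support (measure_mono_null (compl_subset_compl.2 ?_) hσsupp) k
    exact Icc_subset_Icc (by norm_num) le_rfl
  refine (hasSum_integral_measure hint).congr_fun fun m => ?_
  rw [integral_smul_measure, ENNReal.toReal_ofReal (hc m), smul_eq_mul, ← (hp m).2.2 k, moment]

theorem map_neg_compl_Icc {μ : Measure ℝ} {a b : ℝ} (h : μ (Icc a b)ᶜ = 0) :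
    μ.map Neg.neg (Icc (-b) (-a))ᶜ = 0 := by
  rw [Measure.map_apply measurable_neg measurableSet_Icc.compl]
  convert h using 2
  ext x
  simp only [mem_preimage, mem_compl_iff, mem_Icc]
  constructor <;> intro h1 h2 <;> exact h1 ⟨by linarith [h2.1, h2.2], by linarith [h2.1, h2.2]⟩

theorem momentSeqs_mono {K L : Set ℝ} (h : K ⊆ L) : momentSeqs K ⊆ momentSeqs L := by
  rintro s ⟨μ, hμ, hs⟩
  exact ⟨μ, ⟨hμ.1, measure_mono_null (compl_subset_compl.2 h) hμ.2⟩, hs⟩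

/-! ### Odd extensions of power series preserve moment sequences -/

theorem IsOddAbsMonotonic.odd {F : ℝ → ℝ} (hF : IsOddAbsMonotonic F) : Function.Odd F := by
  obtain ⟨G, -, hpos, h0, hneg⟩ := hF
  intro x
  rcases lt_trichotomy x 0 with hx | rfl | hx
  · have h1 := hneg x hx
    have h2 := hpos (-x) (by linarith)
    push_cast at h2
    rw [← h2] at h1
    have : F x = -F (-x) := by exact_mod_cast h1
    linarith
  · simp [h0]
  · have h1 := hneg (-x) (by linarith)
    have h2 := hpos x hx
    push_cast at h1
    rw [neg_neg, ← h2] at h1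
    exact_mod_cast h1

theorem IsOddAbsMonotonic.mapsTo {F : ℝ → ℝ} (hF : IsOddAbsMonotonic F) :
    MapsTo (entrywise F) (momentSeqs (Icc (-1) 0)) (momentSeqs (Icc (-1) 0)) := by
  have hodd := hF.odd
  obtain ⟨G, hG, hpos, h0, -⟩ := hF
  obtain ⟨c, hc, hsum⟩ := hG.exists_hasSum
  have hFsum : ∀ x : ℝ, 0 < x → HasSum (fun m => c m * x ^ m) (F x) := by
    intro x hx
    have := hsum x
    rw [← hpos x hx] at this
    exact_mod_cast this
  have hF0 : ∀ x : ℝ, 0 ≤ x → 0 ≤ F x := by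
    intro x hx
    rcases hx.eq_or_lt with rfl | hx
    · exact h0.ge
    · exact (hFsum x hx).nonneg fun m => mul_nonneg (hc m) (by positivity)
  rintro s ⟨μ, hμ, hs⟩
  have hμf := isFiniteMeasure_of_mem hμ
  set ν : Measure ℝ := μ.map Neg.neg with hν
  have hνs : ν (Icc 0 1)ᶜ = 0 := by simpa using map_neg_compl_Icc hμ.2
  have hνae : ∀ᵐ x ∂ν, x ∈ Icc (0 : ℝ) 1 := mem_ae_iff.2 hνs
  have hνi : ∀ k, Integrable (fun x : ℝ => x ^ k) ν := integrable_pow_of_support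
    (measure_mono_null (compl_subset_compl.2 (Icc_subset_Icc (by norm_num) le_rfl)) hνs)
  have hν0 : ∀ k, 0 ≤ moment ν k := fun k => integral_nonneg_of_ae (by
    filter_upwards [hνae] with x hx using pow_nonneg hx.1 k)
  have hsν : ∀ k, s k = (-1) ^ k * moment ν k := fun k => by
    rw [hs, hν, moment_map_neg, ← mul_assoc, ← mul_pow]
    simp
  have hFs : ∀ k, F (s k) = (-1) ^ k * F (moment ν k) := by
    intro k
    rw [hsν]
    rcases neg_one_pow_eq_or ℝ k with h | h <;> rw [h]
    · simp
    · rw [neg_one_mul, neg_one_mul, hodd]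
  by_cases hall : ∀ k, 0 < moment ν k
  · obtain ⟨σ, hσf, hσs, hσ⟩ :=
      exists_measure_powerSeries hνs hc (hFsum _ (hall 0)).summable
    have hms : (σ.map Neg.neg) (Icc (-1) 0)ᶜ = 0 := by simpa using map_neg_compl_Icc hσs
    refine ⟨σ.map Neg.neg, ⟨integrable_pow_of_support (measure_mono_null
      (compl_subset_compl.2 (Icc_subset_Icc le_rfl (by norm_num))) hms), hms⟩, fun k => ?_⟩
    rw [moment_map_neg, entrywise, hFs, (hFsum _ (hall k)).unique (hσ k)]
  -- A vanishing moment forces `ν` to live on `{0}`. The series could be wrong here, as `F 0 = 0`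
  -- while `G 0` may be positive; a point mass at `0` serves instead.
  · push Not at hall
    obtain ⟨k, hk⟩ := hall
    have hk0 : moment ν k = 0 := le_antisymm hk (hν0 k)
    have hae : (fun x : ℝ => x ^ k) =ᵐ[ν] 0 := (integral_eq_zero_iff_of_nonneg_ae (by
      filter_upwards [hνae] with x hx using pow_nonneg hx.1 k) (hνi k)).1 hk0
    have hzero : ∀ j, j ≠ 0 → moment ν j = 0 := by
      intro j hj
      refine integral_eq_zero_of_ae ?_
      filter_upwards [hae] with x hx
      have : x = 0 := eq_zero_of_pow_eq_zero hx
      simp [this, hj]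
    refine ⟨ENNReal.ofReal (F (moment ν 0)) • Measure.dirac 0, ⟨fun j => ?_, ?_⟩, fun j => ?_⟩
    · exact (integrable_dirac (by simp)).smul_measure ENNReal.ofReal_ne_top
    · simp
    · rw [moment, integral_smul_measure, integral_dirac, ENNReal.toReal_ofReal (hF0 _ (hν0 0)),
        entrywise, hFs]
      rcases eq_or_ne j 0 with rfl | hj
      · simp
      · simp [hzero j hj, h0, hj]

/-- The sign function comes from the constant `G = 1`. -/
theorem exists_isOddAbsMonotonic_not_continuousAt :
    ∃ F : ℝ → ℝ, IsOddAbsMonotonic F ∧ ¬ ContinuousAt F 0 := by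
  refine ⟨Real.sign, ⟨fun _ => 1, ⟨differentiable_const _, fun x _ n => ?_⟩, fun x hx => ?_,
    Real.sign_zero, fun x hx => ?_⟩, fun h => ?_⟩
  · rw [iteratedDeriv_const]
    split_ifs <;> simp
  · simp [Real.sign_of_pos hx]
  · simp [Real.sign_of_neg hx]
  · have h1 : Tendsto Real.sign (𝓝[>] 0) (𝓝 (Real.sign 0)) :=
      h.tendsto.mono_left nhdsWithin_le_nhds
    have h2 : Tendsto Real.sign (𝓝[>] 0) (𝓝 1) := by
      refine tendsto_const_nhds.congr' ?_
      filter_upwards [self_mem_nhdsWithin] with x hx using (Real.sign_of_pos hx).symm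
    have := tendsto_nhds_unique h1 h2
    simp at this

/-! ### Consequences of the preservation of moment sequences -/

theorem integral_polynomial {K : Set ℝ} {μ : Measure ℝ} (hμ : μ ∈ admissibleMeasures K)
    (q : ℝ[X]) (j : ℕ) :
    ∫ x, q.eval (x ^ j) ∂μ = ∑ k ∈ q.support, q.coeff k * moment μ (j * k) := by
  simp_rw [Polynomial.eval_eq_sum, Polynomial.sum_def, ← pow_mul]
  rw [integral_finsetSum _ fun k _ => (hμ.1 _).const_mul _]
  simp_rw [integral_const_mul, moment]

/-- The measure `a δ_x + b δ_y` and its moments. -/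
theorem exists_two_atoms {K : Set ℝ} {x y : ℝ} (hx : x ∈ K) (hy : y ∈ K) (hK : MeasurableSet K)
    {a b : ℝ} (ha : 0 ≤ a) (hb : 0 ≤ b) :
    ∃ μ ∈ admissibleMeasures K, ∀ k, moment μ k = a * x ^ k + b * y ^ k := by
  have hi : ∀ (z c : ℝ) (k : ℕ),
      Integrable (fun t : ℝ => t ^ k) (ENNReal.ofReal c • Measure.dirac z) := fun z c k =>
    (integrable_dirac (by simp)).smul_measure ENNReal.ofReal_ne_top
  refine ⟨ENNReal.ofReal a • Measure.dirac x + ENNReal.ofReal b • Measure.dirac y,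
    ⟨fun k => (hi x a k).add_measure (hi y b k), ?_⟩, fun k => ?_⟩
  · simp [Measure.dirac_apply' _ hK.compl, hx, hy]
  · rw [moment, integral_add_measure (hi x a k) (hi y b k), integral_smul_measure,
      integral_smul_measure, integral_dirac, integral_dirac, ENNReal.toReal_ofReal ha,
      ENNReal.toReal_ofReal hb, smul_eq_mul, smul_eq_mul]

/-- The moments of `a δ₋₁ + b δ₀` are `a + b, -a, a, -a, a`. Integrating `x(1+x)²` and `x²(1+x)²`
bounds `F a + F (-a)` from both sides by `0`; `(1+x)²` then gives monotonicity. -/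
theorem odd_monotone_of_mapsTo {F : ℝ → ℝ}
    (h : MapsTo (entrywise F) (truncMomentSeqs 4 {-1, 0}) (truncMomentSeqs 4 (Iic 0)))
    {a b : ℝ} (ha : 0 ≤ a) (hb : 0 ≤ b) :
    0 ≤ F a ∧ F (-a) = -F a ∧ F a ≤ F (a + b) := by
  obtain ⟨μ, hμ, hm⟩ := exists_two_atoms (K := {-1, 0}) (x := -1) (y := 0) (by simp) (by simp)
    (by measurability) ha hb
  obtain ⟨σ, hσ, hs⟩ := h ⟨μ, hμ, fun k => rfl⟩
  have hi := hσ.1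
  have ht : ∀ k (hk : k < 5), F (a * (-1) ^ k + b * 0 ^ k) = ∫ x : ℝ, x ^ k ∂σ := by
    intro k hk
    rw [← hm]
    exact hs ⟨k, hk⟩
  have t0 : F (a + b) = ∫ x : ℝ, x ^ 0 ∂σ :=
    (congrArg F (by norm_num)).trans (ht 0 (by norm_num))
  have t1 : F (-a) = ∫ x : ℝ, x ^ 1 ∂σ :=
    (congrArg F (by norm_num)).trans (ht 1 (by norm_num))
  have t2 : F a = ∫ x : ℝ, x ^ 2 ∂σ :=
    (congrArg F (by norm_num)).trans (ht 2 (by norm_num))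
  have t3 : F (-a) = ∫ x : ℝ, x ^ 3 ∂σ :=
    (congrArg F (by norm_num)).trans (ht 3 (by norm_num))
  have t4 : F a = ∫ x : ℝ, x ^ 4 ∂σ :=
    (congrArg F (by norm_num)).trans (ht 4 (by norm_num))
  have hae : ∀ᵐ x ∂σ, x ≤ 0 := mem_ae_iff.2 hσ.2
  have comb : ∀ i j k : ℕ, ∫ x : ℝ, (x ^ i + 2 * x ^ j + x ^ k) ∂σ =
      (∫ x : ℝ, x ^ i ∂σ) + 2 * (∫ x : ℝ, x ^ j ∂σ) + ∫ x : ℝ, x ^ k ∂σ := by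
    intro i j k
    have hij : Integrable (fun x : ℝ => x ^ i + 2 * x ^ j) σ := (hi i).add ((hi j).const_mul 2)
    rw [integral_add hij (hi k), integral_add (hi i) ((hi j).const_mul 2), integral_const_mul]
  have p0 : 0 ≤ ∫ x : ℝ, (x ^ 0 + 2 * x ^ 1 + x ^ 2) ∂σ :=
    integral_nonneg fun x => by
      simp only [Pi.zero_apply]
      nlinarith [sq_nonneg (1 + x)]
  have p1 : ∫ x : ℝ, (x ^ 1 + 2 * x ^ 2 + x ^ 3) ∂σ ≤ 0 := by
    refine integral_nonpos_of_ae ?_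
    filter_upwards [hae] with x hx
    simp only [Pi.zero_apply]
    nlinarith [mul_nonneg (neg_nonneg.2 hx) (sq_nonneg (1 + x))]
  have p2 : 0 ≤ ∫ x : ℝ, (x ^ 2 + 2 * x ^ 3 + x ^ 4) ∂σ :=
    integral_nonneg fun x => by
      simp only [Pi.zero_apply]
      nlinarith [sq_nonneg (x * (1 + x))]
  have p3 : 0 ≤ ∫ x : ℝ, x ^ 2 ∂σ := integral_nonneg fun x => sq_nonneg x
  rw [comb, ← t0, ← t1, ← t2] at p0
  rw [comb, ← t1, ← t2, ← t3] at p1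
  rw [comb, ← t2, ← t3, ← t4] at p2
  rw [← t2] at p3
  exact ⟨p3, by linarith, by linarith⟩

/-- The sum is the integral of `q(x²)` against the image measure; only even moments enter, hence the
ratio `u²`. -/
theorem sum_coeff_nonneg_of_mapsTo {F : ℝ → ℝ} {u : ℝ}
    (h : MapsTo (entrywise F) (momentSeqs {-1, -u}) (momentSeqs (Iic 0)))
    {q : ℝ[X]} (hq : ∀ x, 0 ≤ q.eval x) {a b : ℝ} (ha : 0 ≤ a) (hb : 0 ≤ b) :
    0 ≤ ∑ k ∈ q.support, q.coeff k * F (a + b * (u ^ 2) ^ k) := by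
  obtain ⟨μ, hμ, hm⟩ := exists_two_atoms (K := {-1, -u}) (x := -1) (y := -u) (by simp) (by simp)
    (by measurability) ha hb
  obtain ⟨σ, hσ, hs⟩ := h ⟨μ, hμ, fun k => rfl⟩
  have h1 : ∀ k, F (a + b * (u ^ 2) ^ k) = moment σ (2 * k) := by
    intro k
    rw [← hs, entrywise, hm, pow_mul, pow_mul]
    simp
  simp_rw [h1, ← integral_polynomial hσ q 2]
  exact integral_nonneg fun x => hq _

theorem isOddAbsMonotonic_of_mapsTo {F : ℝ → ℝ} {u : ℝ} (hu : u ∈ Ioo (0 : ℝ) 1)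
    (h1 : MapsTo (entrywise F) (momentSeqs {-1, -u}) (momentSeqs (Iic 0)))
    (h2 : MapsTo (entrywise F) (truncMomentSeqs 4 {-1, 0}) (truncMomentSeqs 4 (Iic 0))) :
    IsOddAbsMonotonic F := by
  have hF : ∀ a b : ℝ, 0 ≤ a → 0 ≤ b → 0 ≤ F a ∧ F (-a) = -F a ∧ F a ≤ F (a + b) :=
    fun a b => odd_monotone_of_mapsTo h2
  -- Cutting off at `0` gives a function monotone on all of `ℝ`, ready for mollification.
  set f : ℝ → ℝ := fun x => if 0 < x then F x else 0 with hf
  have hfpos : ∀ x, 0 < x → f x = F x := fun x hx => if_pos hx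
  have hf0 : ∀ x ≤ 0, f x = 0 := fun x hx => if_neg hx.not_gt
  have hmono : Monotone f := by
    intro x y hxy
    rcases lt_or_ge 0 x with hx | hx
    · rw [hfpos x hx, hfpos y (hx.trans_le hxy)]
      simpa using (hF x (y - x) hx.le (by linarith)).2.2
    · rw [hf0 x hx]
      rcases lt_or_ge 0 y with hy | hy
      · rw [hfpos y hy]
        exact (hF y 0 hy.le le_rfl).1
      · rw [hf0 y hy]
  obtain ⟨c, hc, hs, hsum⟩ := exists_powerSeries_of_monotone hmono (v := u ^ 2)
    (pow_pos hu.1 2) (pow_lt_one₀ hu.1.le hu.2 two_ne_zero) fun q hq a b ha hb => by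
      have := sum_coeff_nonneg_of_mapsTo h1 hq ha.le hb.le
      refine this.trans_eq (Finset.sum_congr rfl fun k _ => ?_)
      have hu0 := hu.1
      rw [hfpos _ (by positivity)]
  have hFG : ∀ x : ℝ, 0 < x → (F x : ℂ) = ∑' m, (c m : ℂ) * (x : ℂ) ^ m := by
    intro x hx
    rw [← hfpos x hx, hsum x hx]
    push_cast
    rfl
  refine ⟨_, absMonotonicEntire_tsum hc hs, hFG, ?_, fun x hx => ?_⟩
  · have := (hF 0 0 le_rfl le_rfl).2.1
    rw [neg_zero] at this
    linarith
  · have h3 := (hF (-x) 0 (by linarith) le_rfl).2.1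
    rw [neg_neg] at h3
    rw [h3]
    have h4 := hFG (-x) (by linarith)
    push_cast at h4 ⊢
    rw [h4]

theorem mapsTo_truncMomentSeqs {F : ℝ → ℝ} {K L : Set ℝ}
    (h : MapsTo (entrywise F) (momentSeqs K) (momentSeqs L)) (n : ℕ) :
    MapsTo (entrywise F) (truncMomentSeqs n K) (truncMomentSeqs n L) := by
  rintro s ⟨μ, hμ, hs⟩
  obtain ⟨σ, hσ, ht⟩ := h ⟨μ, hμ, fun k => rfl⟩
  exact ⟨σ, hσ, fun k => by rw [← ht, entrywise, entrywise, hs]⟩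

theorem truncMomentSeqs_mono {n : ℕ} {K L : Set ℝ} (h : K ⊆ L) :
    truncMomentSeqs n K ⊆ truncMomentSeqs n L := by
  rintro s ⟨μ, hμ, hs⟩
  exact ⟨μ, ⟨hμ.1, measure_mono_null (compl_subset_compl.2 h) hμ.2⟩, hs⟩

end MomentTransforms

end

theorem theorem6p1 :
    (∀ (F : ℝ → ℝ) (u₀ : ℝ), u₀ ∈ Ioo (0 : ℝ) 1 →
      List.TFAE [
        MapsTo (MomentTransforms.entrywise F)
            (MomentTransforms.momentSeqs {-1, -u₀}) (MomentTransforms.momentSeqs (Iic 0)) ∧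
          MapsTo (MomentTransforms.entrywise F)
            (MomentTransforms.truncMomentSeqs 4 {-1, 0} ∪
              ⋃ u ∈ Ioo (0 : ℝ) 1, MomentTransforms.truncMomentSeqs 4 {-u})
            (MomentTransforms.truncMomentSeqs 4 (Iic 0)),
        MapsTo (MomentTransforms.entrywise F)
          (MomentTransforms.momentSeqs (Icc (-1) 0)) (MomentTransforms.momentSeqs (Icc (-1) 0)),
        MomentTransforms.IsOddAbsMonotonic F]) ∧
    (∀ F : ℝ → ℝ,
      MapsTo (MomentTransforms.entrywise F)
          (MomentTransforms.momentSeqs (Icc (-1) 0)) (MomentTransforms.momentSeqs (Iic 0)) ↔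
        MomentTransforms.IsOddAbsMonotonic F) ∧
    (∀ F : ℝ → ℝ, MomentTransforms.IsOddAbsMonotonic F → Function.Odd F) ∧
    (∃ F : ℝ → ℝ, MomentTransforms.IsOddAbsMonotonic F ∧ ¬ ContinuousAt F 0) := by
  have key : ∀ (F : ℝ → ℝ) (u : ℝ), u ∈ Ioo (0 : ℝ) 1 →
      MapsTo (MomentTransforms.entrywise F)
        (MomentTransforms.momentSeqs (Icc (-1) 0)) (MomentTransforms.momentSeqs (Iic 0)) →
      MapsTo (MomentTransforms.entrywise F)
            (MomentTransforms.momentSeqs {-1, -u}) (MomentTransforms.momentSeqs (Iic 0)) ∧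
          MapsTo (MomentTransforms.entrywise F)
            (MomentTransforms.truncMomentSeqs 4 {-1, 0} ∪
              ⋃ u ∈ Ioo (0 : ℝ) 1, MomentTransforms.truncMomentSeqs 4 {-u})
            (MomentTransforms.truncMomentSeqs 4 (Iic 0)) := by
    intro F u hu h
    refine ⟨h.mono_left (MomentTransforms.momentSeqs_mono ?_),
      (MomentTransforms.mapsTo_truncMomentSeqs h 4).mono_left
        (union_subset (MomentTransforms.truncMomentSeqs_mono ?_)
          (iUnion₂_subset fun v hv => MomentTransforms.truncMomentSeqs_mono ?_))⟩
    · rintro x (rfl | rfl)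
      · norm_num
      · exact ⟨by linarith [hu.2], by linarith [hu.1]⟩
    · rintro x (rfl | rfl) <;> norm_num
    · rintro x rfl
      exact ⟨by linarith [hv.2], by linarith [hv.1]⟩
  have hIic : MomentTransforms.momentSeqs (Icc (-1) 0) ⊆ MomentTransforms.momentSeqs (Iic 0) :=
    MomentTransforms.momentSeqs_mono Icc_subset_Iic_self
  refine ⟨fun F u hu => ?_, fun F => ⟨fun h => ?_, fun h => h.mapsTo.mono_right hIic⟩,
    fun F hF => hF.odd, MomentTransforms.exists_isOddAbsMonotonic_not_continuousAt⟩
  · tfae_have 1 → 3 := fun h =>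
      MomentTransforms.isOddAbsMonotonic_of_mapsTo hu h.1 (h.2.mono_left subset_union_left)
    tfae_have 3 → 2 := fun h => h.mapsTo
    tfae_have 2 → 1 := fun h => key F u hu (h.mono_right hIic)
    tfae_finish
  -- This equivalence involves no `u₀`; any point of `(0, 1)` would serve.
  · have hu : (1 / 2 : ℝ) ∈ Ioo (0 : ℝ) 1 := by norm_num
    have := key F _ hu h
    exact MomentTransforms.isOddAbsMonotonic_of_mapsTo hu this.1
      (this.2.mono_left subset_union_left)
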